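/- **Setting.** A system $\mathcal T=(S,s_0,I\uplus O,\delta,l)$ has a finite set $S$ of states, an initial state $s_0$, finite sets $I$ of inputs and $O$ of outputs, $\delta:S\times 2^I\to 2^S$ and $l:S\to 2^O$; its size is $|\mathcal T|=|S|$. Its traces are the words $\pi\in(2^{I\cup O})^\omega$ for which there are states $s_0,s_1,\dots$ and sets $A_t\subseteq I$ with $s_{t+1}\in\delta(s_t,A_t)$ and $\pi_t=A_t\cup l(s_{t+1})$ for all $t\ge 0$. For words $\pi,\sigma,\rho$ write $\sigma\le_\pi\rho$ if for every position $t$ and input $i\in I$ on which $\sigma_t$ and $\pi_t$ differ, $\rho_t$ and $\pi_t$ also differ on $i$ (the subset similarity relation). A set $C\subseteq(2^I)^\omega$ is a cause of an effect $E\subseteq(2^{I\cup O})^\omega$ on a trace $\pi$ of $\mathcal T$ if (SAT) every trace $\pi'$ of $\mathcal T$ with the same inputs as $\pi$ satisfies $\pi'|_I\in C$ and $\pi'\in E$; (CF) for every $\rho\in(2^I)^\omega\setminus C$ there is a trace $\pi''$ of $\mathcal T$ with $\pi''\le_\pi\rho$ and $\pi''\notin E$; (MIN) no proper subset of $C$ satisfies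 SAT and CF. A language $L$ of infinite words is a safety, guarantee, recurrence, or persistence property if, for some set $\Phi$ of finite words, it consists of the infinite words of which all, at least one, infinitely many, or only finitely many prefixes, respectively, are in $\Phi$. NBW, DBW and DCW are nondeterministic Büchi, deterministic Büchi and deterministic co-Büchi word automata; their size is the number of states. The size of an ultimately periodic trace $uv^\omega$ is $|u|+|v|$. **Theorem.** The following worst-case lower bounds hold for the size of NBWs for causes with respect to the size of the system, for effects and traces of constant size. There are constants $K,N\in\mathbb N$ and $c>0$ such that for every $n\ge N$: 1. there are a system $\mathcal T$ with exactly $n$ states, a trace $\pi$ of $\mathcal T$ of size at most $K$, and a persistence effect $E$, given by a DCW with at most $K$ states, such that $E$ has a cause on $\pi$ in $\mathcal T$ and every NBW that recognizes this cause has at least $2^{c\,n\log_2 n}$ states, i.e. $2^{\Omega(|\mathcal T|\log|\mathcal T|)}$; 2. the same holds with a recurrence effect, given by a DBW with at most $K$ states, and at least $c\cdot 3^{n}$ states, i.e. $\Omega(3^{|\mathcal T|})$; 3. the same holds with a safety effect, and also with a guarantee effect, each given by a DBW with at most $K$ states, and at least $c\cdot 2^{n}$ states, i.e. $\Omega(2^{|\mathcal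 T|})$. -/

import Mathlib

/-- An infinite word `w 0, w 1, w 2, …` over the alphabet `A`. -/
abbrev OmegaWord (A : Type) : Type := ℕ → A

/-- The prefix of length `n` of an infinite word. -/
def OmegaWord.pre {A : Type} (w : OmegaWord A) (n : ℕ) : List A :=
  (List.range n).map w

/-! ### The classes of the hierarchy of temporal properties -/

/-- Safety: for some set `Φ` of finite words, the words all of whose prefixes are in `Φ`. -/
def IsSafety {A : Type} (L : Set (OmegaWord A)) : Prop :=
  ∃ Φ : Set (List A), L = {w | ∀ n, w.pre n ∈ Φ}

/-- Guarantee: for some set `Φ` of finite words, the words with some prefix in `Φ`. -/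
def IsGuarantee {A : Type} (L : Set (OmegaWord A)) : Prop :=
  ∃ Φ : Set (List A), L = {w | ∃ n, w.pre n ∈ Φ}

/-- Recurrence: for some set `Φ` of finite words, the words with infinitely many prefixes in `Φ`
(prefixes of different lengths are different, so it suffices to count lengths). -/
def IsRecurrence {A : Type} (L : Set (OmegaWord A)) : Prop :=
  ∃ Φ : Set (List A), L = {w | {n | w.pre n ∈ Φ}.Infinite}

/-- Persistence: for some set `Φ` of finite words, the words with only finitely many prefixes
in `Φ`. -/
def IsPersistence {A : Type} (L : Set (OmegaWord A)) : Prop :=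
  ∃ Φ : Set (List A), L = {w | {n | w.pre n ∈ Φ}.Finite}

/-! ### Automata on infinite words -/

/-- An automaton over the alphabet `A` with set of states `Q`; its size is the number of elements
of `Q`, which is required to be finite wherever automata are used below. -/
structure OmegaAutomaton (A Q : Type) where
  /-- the initial states -/
  init : Set Q
  /-- the accepting states -/
  acc : Set Q
  /-- the transition relation: the possible successors of a state under a letter -/
  trans : Q → A → Set Q

namespace OmegaAutomaton

variable {A Q : Type}

/-- `r` is a run of the automaton on the infinite word `w`. -/
def IsRun (M : OmegaAutomaton A Q) (w : OmegaWord A) (r : ℕ → Q) : Prop :=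
  r 0 ∈ M.init ∧ ∀ t, r (t + 1) ∈ M.trans (r t) (w t)

/-- The language under the nondeterministic Büchi condition: some run visits accepting states
infinitely often. -/
def buchiLanguage (M : OmegaAutomaton A Q) : Set (OmegaWord A) :=
  {w | ∃ r, M.IsRun w r ∧ {t | r t ∈ M.acc}.Infinite}

/-- The language under the nondeterministic co-Büchi condition: some run visits the set `acc` only
finitely often. -/
def coBuchiLanguage (M : OmegaAutomaton A Q) : Set (OmegaWord A) :=
  {w | ∃ r, M.IsRun w r ∧ ∃ j, ∀ t > j, r t ∉ M.acc}

/-- Exactly one initial state, and exactly one successor for every state and letter. -/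
def IsDeterministic (M : OmegaAutomaton A Q) : Prop :=
  (∃ q, M.init = {q}) ∧ ∀ q a, ∃ q', M.trans q a = {q'}

end OmegaAutomaton

/-- `L` is recognized by a deterministic Büchi automaton (DBW) with at most `K` states. -/
def HasDBW {A : Type} (K : ℕ) (L : Set (OmegaWord A)) : Prop :=
  ∃ (Q : Type) (_ : Fintype Q) (D : OmegaAutomaton A Q),
    D.IsDeterministic ∧ D.buchiLanguage = L ∧ Fintype.card Q ≤ K

/-- `L` is recognized by a deterministic co-Büchi automaton (DCW) with at most `K` states. -/
def HasDCW {A : Type} (K : ℕ) (L : Set (OmegaWord A)) : Prop :=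
  ∃ (Q : Type) (_ : Fintype Q) (D : OmegaAutomaton A Q),
    D.IsDeterministic ∧ D.coBuchiLanguage = L ∧ Fintype.card Q ≤ K

/-- The word has the form `u v v v …` with `v` non-empty and `|u| + |v| ≤ K`. -/
def HasLasso {A : Type} (K : ℕ) (w : OmegaWord A) : Prop :=
  ∃ p q : ℕ, 0 < q ∧ p + q ≤ K ∧ ∀ t ≥ p, w (t + q) = w t

/-! ### Systems and their traces -/

/-- A system with inputs `I`, outputs `O` (the atomic propositions are the disjoint union `I ⊕ O`)
and states `S`; its size is the number of elements of `S`. -/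
structure ReactiveSystem (I O S : Type) where
  /-- the initial state -/
  init : S
  /-- the possible successors of a state under a set of inputs -/
  trans : S → Set I → Set S
  /-- the outputs that are set in a state -/
  label : S → Set O

/-- The traces of a system: position `t` shows the inputs read in step `t` and the label of the
state reached by that step (so the label of the initial state is not shown). -/
def ReactiveSystem.traces {I O S : Type} (T : ReactiveSystem I O S) :
    Set (OmegaWord (Set (I ⊕ O))) :=
  {π | ∃ s : ℕ → S, s 0 = T.init ∧ ∀ t, ∃ X : Set I,
    π t = Sum.inl '' X ∪ Sum.inr '' T.label (s (t + 1)) ∧ s (t + 1) ∈ T.trans (s t) X}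

/-- The restriction of a word over `2^(I ∪ O)` to the inputs. -/
def inputPart {I O : Type} (π : OmegaWord (Set (I ⊕ O))) : OmegaWord (Set I) :=
  fun t => Sum.inl ⁻¹' π t

/-! ### Temporal causes -/

/-- The subset similarity relation `π₁ ≤ π₂` with respect to `π₀`: wherever `π₁` differs from `π₀`
in an input, `π₂` differs from `π₀` in that input, too. Only inputs matter, so the relation is
defined on input words. -/
def SubsetSimilar {I : Type} (π₀ π₁ π₂ : OmegaWord (Set I)) : Prop :=
  ∀ t, ∀ i : I, ¬ (i ∈ π₀ t ↔ i ∈ π₁ t) → ¬ (i ∈ π₀ t ↔ i ∈ π₂ t)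

section Causes

variable {I O S : Type}

/-- Condition SAT: the traces with the inputs of `π` satisfy the cause and the effect. -/
def CauseSat (T : ReactiveSystem I O S) (π : OmegaWord (Set (I ⊕ O)))
    (E : Set (OmegaWord (Set (I ⊕ O)))) (C : Set (OmegaWord (Set I))) : Prop :=
  ∀ π' ∈ T.traces, inputPart π' = inputPart π → inputPart π' ∈ C ∧ π' ∈ E

/-- Condition CF: for every input word outside the cause there is a trace that is at least as
similar to `π` and violates the effect. -/
def CauseCF (T : ReactiveSystem I O S) (π : OmegaWord (Set (I ⊕ O)))
    (E : Set (OmegaWord (Set (I ⊕ O)))) (C : Set (OmegaWord (Set I))) : Prop :=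
  ∀ ρ, ρ ∉ C → ∃ π' ∈ T.traces, SubsetSimilar (inputPart π) (inputPart π') ρ ∧ π' ∉ E

/-- `C` is a cause of the effect `E` on the trace `π` in the system `T`: conditions SAT, CF and
MIN hold, where MIN says that no proper subset of `C` satisfies SAT and CF. -/
structure IsCause (T : ReactiveSystem I O S) (π : OmegaWord (Set (I ⊕ O)))
    (E : Set (OmegaWord (Set (I ⊕ O)))) (C : Set (OmegaWord (Set I))) : Prop where
  mem_traces : π ∈ T.traces
  sat : CauseSat T π E C
  cf : CauseCF T π E C
  min : ¬ ∃ C', C' ⊂ C ∧ CauseSat T π E C' ∧ CauseCF T π E C'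

end Causes

/-! ### Lower bounds on the size of causes -/

/-- A class of effects: a predicate on languages over `2^(I ∪ O)`, for all `I` and `O`. -/
abbrev EffectClass : Type 1 :=
  ∀ I O : Type, Set (OmegaWord (Set (I ⊕ O))) → Prop

/-- There is a system with exactly `n` states (and finitely many inputs and outputs), a trace `π`
of it of size at most `K` and an effect `E` in the class `P` such that `E` has a cause on `π`, and
every NBW that recognizes this cause has at least `b` states. -/
def SomeCauseRequires (P : EffectClass) (K n : ℕ) (b : ℝ) : Prop :=
  ∃ (I O S : Type) (_ : Fintype I) (_ : Fintype O) (_ : Fintype S)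
    (T : ReactiveSystem I O S) (π : OmegaWord (Set (I ⊕ O)))
    (E : Set (OmegaWord (Set (I ⊕ O)))) (C : Set (OmegaWord (Set I))),
    Fintype.card S = n ∧ HasLasso K π ∧ P I O E ∧ IsCause T π E C ∧
    ∀ (Q : Type) [Fintype Q] (B : OmegaAutomaton (Set I) Q),
      B.buchiLanguage = C → b ≤ (Fintype.card Q : ℝ)

/-- Persistence effects that are given by a DCW with at most `K` states. -/
def PersistenceEffect (K : ℕ) : EffectClass :=
  fun _ _ E => IsPersistence E ∧ HasDCW K E

/-- Recurrence effects that are given by a DBW with at most `K` states. -/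
def RecurrenceEffect (K : ℕ) : EffectClass :=
  fun _ _ E => IsRecurrence E ∧ HasDBW K E

/-- Safety effects that are given by a DBW with at most `K` states. -/
def SafetyEffect (K : ℕ) : EffectClass :=
  fun _ _ E => IsSafety E ∧ HasDBW K E

/-- Guarantee effects that are given by a DBW with at most `K` states. -/
def GuaranteeEffect (K : ℕ) : EffectClass :=
  fun _ _ E => IsGuarantee E ∧ HasDBW K E

/-!
All systems are given by directed multigraphs: the inputs are the edges, a step along the edge `i`
reads the input set `{i}`, and the empty input set leads to a sink. The states of the system of
size `n` are `n - 2` vertices, the initial state and the sink. The trace `π` is the one without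
inputs, so that `σ ≤_π ρ` means that `σ` is pointwise contained in `ρ`. A word `ρ` of edge sets is
then the same as a graph that changes over time, and the traces contained in `ρ` are the paths
through it, which may end in the sink. The cause of `E` consists of all `ρ` such that every path
through `ρ` satisfies `E` (`graphCause_isCause`). It is thus the complement of the language of a
nondeterministic automaton whose transitions at every position are chosen by the letter, and the
lower bounds are those for the complementation of such automata.

*Safety, guarantee, recurrence.* All edges are loops, and the words are `u X · w Y`, where the
first letter offers the loops in `X` and the remainder offers those in `Y` (for safety effects,
marked copies of them, once). The effect is violated by a path that uses the same loop at first and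
later on, so that `u X · w Y` is in the cause if and only if `X` and `Y` are disjoint. An automaton
for the cause therefore needs as many states as there are sets `X` (`two_pow_le_card_of_disjoint`).
For recurrence effects, every vertex carries two loops of different colours, and the four states of
the effect's automaton suffice to notice a change of colour. Then there are `4 ^ (n - 2)` sets of
loops, which exceeds the required multiple of `3 ^ n`.

*Persistence.* The effect says that marked edges are used finitely often. A permutation `σ` ranks
the vertices; if marked edges have to decrease the rank and unmarked ones have to keep it, marked
edges occur finitely often, so the constant word of `rankGraph σ` is in the cause. If `σ ≠ τ`, some
marked edge of `rankGraph σ` is the converse of a marked edge of `rankGraph τ`, so words that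
alternate between the two graphs are not in the cause. As in Michel's lower bound for the
complementation of Büchi automata, no accepting state can then be visited infinitely often in
accepting runs on both constant words, because loops at this state could be alternated. Hence there
are at least `(n - 2)!` states (`factorial_le_card_of_buchiLanguage_eq`).
-/

/-! ### Deterministic automata and classes of effects -/

section Deterministic

variable {A Q : Type}

/-- The run of the deterministic automaton with transition function `step` and initial state `q₀`
on an infinite word. -/
def detRun (step : Q → A → Q) (q₀ : Q) (w : OmegaWord A) : ℕ → Q
  | 0 => q₀
  | t + 1 => step (detRun step q₀ w t) (w t)

theorem detRun_eq_foldl (step : Q → A → Q) (q₀ : Q) (w : OmegaWord A) (t : ℕ) :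
    detRun step q₀ w t = (w.pre t).foldl step q₀ := by
  induction t with
  | zero => rfl
  | succ t ih =>
    rw [detRun, ih]
    simp [OmegaWord.pre, List.range_succ]

/-- The automaton with one initial state `q₀`, transition function `step` and accepting set `G`. -/
def detAutomaton (step : Q → A → Q) (q₀ : Q) (G : Set Q) : OmegaAutomaton A Q where
  init := {q₀}
  acc := G
  trans q a := {step q a}

theorem detAutomaton_isDeterministic (step : Q → A → Q) (q₀ : Q) (G : Set Q) :
    (detAutomaton step q₀ G).IsDeterministic :=
  ⟨⟨q₀, rfl⟩, fun q a => ⟨step q a, rfl⟩⟩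

theorem detAutomaton_isRun_iff (step : Q → A → Q) (q₀ : Q) (G : Set Q) (w : OmegaWord A)
    (r : ℕ → Q) : (detAutomaton step q₀ G).IsRun w r ↔ r = detRun step q₀ w := by
  constructor
  · rintro ⟨h0, h⟩
    funext t
    induction t with
    | zero => exact h0
    | succ t ih => rw [detRun, ← ih]; exact h t
  · rintro rfl
    exact ⟨rfl, fun t => rfl⟩

theorem detAutomaton_buchiLanguage (step : Q → A → Q) (q₀ : Q) (G : Set Q) :
    (detAutomaton step q₀ G).buchiLanguage = {w | {t | detRun step q₀ w t ∈ G}.Infinite} := by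
  ext w
  simp only [OmegaAutomaton.buchiLanguage, detAutomaton_isRun_iff, Set.mem_ofPred_eq,
    exists_eq_left]
  rfl

theorem detAutomaton_coBuchiLanguage (step : Q → A → Q) (q₀ : Q) (G : Set Q) :
    (detAutomaton step q₀ G).coBuchiLanguage = {w | {t | detRun step q₀ w t ∈ G}.Finite} := by
  ext w
  simp only [OmegaAutomaton.coBuchiLanguage, detAutomaton_isRun_iff, Set.mem_ofPred_eq,
    exists_eq_left]
  constructor
  · rintro ⟨j, hj⟩
    refine (Set.finite_Iic j).subset fun t ht => ?_
    by_contra h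
    exact hj t (not_le.1 h) ht
  · intro h
    obtain ⟨j, hj⟩ := h.bddAbove
    exact ⟨j, fun t ht hG => absurd (hj hG) (not_le.2 ht)⟩

theorem recurrenceEffect_detRun {I O : Type} [Fintype Q] {K : ℕ} (hK : Fintype.card Q ≤ K)
    (step : Q → Set (I ⊕ O) → Q) (q₀ : Q) (G : Set Q) :
    RecurrenceEffect K I O {w | {t | detRun step q₀ w t ∈ G}.Infinite} :=
  ⟨⟨{u | u.foldl step q₀ ∈ G}, by simp [detRun_eq_foldl]⟩,
    Q, inferInstance, detAutomaton step q₀ G, detAutomaton_isDeterministic _ _ _,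
    detAutomaton_buchiLanguage _ _ _, hK⟩

theorem detRun_or_iff (P : A → Prop) (w : OmegaWord A) (t : ℕ) :
    detRun (fun (q : Prop) a => q ∨ P a) False w t ↔ ∃ s < t, P (w s) := by
  induction t with
  | zero => simp [detRun]
  | succ t ih => simp only [detRun, ih, Nat.exists_lt_succ_right]

theorem pre_any_iff (P : A → Prop) (w : OmegaWord A) (t : ℕ) :
    (∃ a ∈ w.pre t, P a) ↔ ∃ s < t, P (w s) := by
  simp [OmegaWord.pre]

theorem safetyEffect_forall_not {I O : Type} (P : Set (I ⊕ O) → Prop) :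
    SafetyEffect 2 I O {w | ∀ t, ¬ P (w t)} := by
  refine ⟨⟨{u | ¬ ∃ a ∈ u, P a}, ?_⟩, Prop, inferInstance,
    detAutomaton (fun q a => q ∨ P a) False {q | ¬ q}, detAutomaton_isDeterministic _ _ _, ?_,
    by simp⟩
  · ext w
    simp only [Set.mem_ofPred_eq, pre_any_iff]
    exact ⟨fun h t ⟨s, _, hs⟩ => h s hs, fun h t ht => h (t + 1) ⟨t, t.lt_succ_self, ht⟩⟩
  · rw [detAutomaton_buchiLanguage]
    ext w
    simp only [Set.mem_ofPred_eq, detRun_or_iff]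
    constructor
    · intro h t ht
      obtain ⟨s, hs, hts⟩ := h.exists_gt t
      exact hs ⟨t, hts, ht⟩
    · intro h
      refine Set.infinite_of_forall_exists_gt fun t => ⟨t + 1, ?_, t.lt_succ_self⟩
      rintro ⟨s, _, hs⟩
      exact h s hs

theorem guaranteeEffect_exists {I O : Type} (P : Set (I ⊕ O) → Prop) :
    GuaranteeEffect 2 I O {w | ∃ t, P (w t)} := by
  refine ⟨⟨{u | ∃ a ∈ u, P a}, ?_⟩, Prop, inferInstance,
    detAutomaton (fun q a => q ∨ P a) False {q | q}, detAutomaton_isDeterministic _ _ _, ?_,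
    by simp⟩
  · ext w
    simp only [Set.mem_ofPred_eq, pre_any_iff]
    exact ⟨fun ⟨t, ht⟩ => ⟨t + 1, t, t.lt_succ_self, ht⟩, fun ⟨_, s, _, hs⟩ => ⟨s, hs⟩⟩
  · rw [detAutomaton_buchiLanguage]
    ext w
    simp only [Set.mem_ofPred_eq, detRun_or_iff]
    constructor
    · intro h
      obtain ⟨_, s, _, hs⟩ := h.nonempty
      exact ⟨s, hs⟩
    · rintro ⟨s, hs⟩
      exact Set.infinite_of_forall_exists_gt fun t =>
        ⟨s + t + 1, ⟨s, by omega, hs⟩, by omega⟩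

theorem persistenceEffect_finite {I O : Type} (P : Set (I ⊕ O) → Prop) :
    PersistenceEffect 2 I O {w | {t | P (w t)}.Finite} := by
  have key : ∀ w : OmegaWord (Set (I ⊕ O)),
      {t | detRun (fun (_ : Prop) a => P a) False w t ∈ {q : Prop | q}}.Finite ↔
        {t | P (w t)}.Finite := by
    intro w
    have : {t | detRun (fun (_ : Prop) a => P a) False w t ∈ {q : Prop | q}} =
        Nat.succ '' {t | P (w t)} := by
      ext t
      cases t <;> simp [detRun]
    rw [this, Set.finite_image_iff Nat.succ_injective.injOn]
  refine ⟨⟨{u | u.foldl (fun _ a => P a) False}, ?_⟩, Prop, inferInstance,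
    detAutomaton (fun _ a => P a) False {q | q}, detAutomaton_isDeterministic _ _ _, ?_,
    by simp⟩
  · ext w
    simp only [Set.mem_ofPred_eq, ← key, detRun_eq_foldl]
  · rw [detAutomaton_coBuchiLanguage]
    ext w
    exact key w

end Deterministic

/-! ### Systems given by directed multigraphs -/

section Graph

variable {I V : Type}

/-- The system of the directed multigraph with vertices `V` and edges `I`. Besides the vertices
`some (some v)` it has an initial state `none` and a sink `some none`. The set `{i}` of inputs
moves along the edge `i` (the initial state may take every edge), the empty set of inputs leads
from every state to the sink, and no other step is possible. There are no outputs. -/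
def graphSystem (src tgt : I → V) : ReactiveSystem I Empty (Option (Option V)) where
  init := none
  trans s X := {s' | (X = ∅ ∧ s' = some none) ∨
    ∃ i, X = {i} ∧ s' = some (some (tgt i)) ∧ (s = none ∨ s = some (some (src i)))}
  label _ := ∅

/-- `s` is a sequence of states of the graph system that reads the input word `x`. -/
def IsGraphRun (src tgt : I → V) (x : OmegaWord (Set I)) (s : ℕ → Option (Option V)) : Prop :=
  s 0 = none ∧ ∀ t, s (t + 1) ∈ (graphSystem src tgt).trans (s t) (x t)

/-- The words `ρ` such that every input word of the graph system that is pointwise contained in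
`ρ` satisfies `E`. -/
def graphCause (src tgt : I → V) (E : Set (OmegaWord (Set I))) : Set (OmegaWord (Set I)) :=
  {ρ | ∀ x s, IsGraphRun src tgt x s → (∀ t, x t ⊆ ρ t) → x ∈ E}

theorem graphSystem_mem_traces_iff (src tgt : I → V) (π : OmegaWord (Set (I ⊕ Empty))) :
    π ∈ (graphSystem src tgt).traces ↔ ∃ s, IsGraphRun src tgt (inputPart π) s := by
  refine exists_congr fun s => and_congr Iff.rfl (forall_congr' fun t => ?_)
  constructor
  · rintro ⟨X, hX, h⟩
    have : inputPart π t = X := by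
      simp [inputPart, hX, Set.preimage_image_eq _ Sum.inl_injective, graphSystem]
    rwa [this]
  · intro h
    refine ⟨_, ?_, h⟩
    ext (i | e)
    · simp [inputPart]
    · exact e.elim

/-- Once the empty set of inputs is read, the system stays in the sink. -/
theorem IsGraphRun.eq_empty_of_le {src tgt : I → V} {x : OmegaWord (Set I)}
    {s : ℕ → Option (Option V)} (h : IsGraphRun src tgt x s) {t : ℕ} (ht : x t = ∅) {t' : ℕ}
    (htt' : t ≤ t') : x t' = ∅ := by
  suffices x t' = ∅ ∧ s (t' + 1) = some none from this.1
  have empty_step : ∀ k, x k = ∅ → s (k + 1) = some none := by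
    intro k hk
    rcases h.2 k with ⟨-, h2⟩ | ⟨i, hi, -⟩
    · exact h2
    · simp [hk] at hi
  induction t', htt' using Nat.le_induction with
  | base => exact ⟨ht, empty_step t ht⟩
  | succ k _ ih =>
    have : x (k + 1) = ∅ := by
      rcases h.2 (k + 1) with ⟨h1, -⟩ | ⟨i, -, -, h3⟩
      · exact h1
      · simp [ih.2] at h3
    exact ⟨this, empty_step _ this⟩

/-- As soon as the word without inputs satisfies the effect, the effect has a cause on it, namely
the largest set of input words all of whose pointwise smaller traces satisfy the effect. -/
theorem graphCause_isCause (src tgt : I → V) (E : Set (OmegaWord (Set I)))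
    (hE : (fun _ => ∅) ∈ E) :
    IsCause (graphSystem src tgt) (fun _ => ∅) (inputPart ⁻¹' E) (graphCause src tgt E) := by
  have h0 : inputPart (fun _ => (∅ : Set (I ⊕ Empty))) = fun _ => ∅ := by
    funext t
    simp [inputPart]
  have hsim : ∀ y ρ : OmegaWord (Set I), SubsetSimilar (fun _ => ∅) y ρ ↔ ∀ t, y t ⊆ ρ t := by
    intro y ρ
    simp [SubsetSimilar, Set.subset_def]
  refine ⟨?_, ?_, ?_, ?_⟩
  · rw [graphSystem_mem_traces_iff, h0]
    refine ⟨fun t => if t = 0 then none else some none, rfl, fun t => Or.inl ⟨rfl, rfl⟩⟩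
  · intro π' _ hin
    rw [h0] at hin
    refine ⟨fun x s _ hx => ?_, by simpa [hin] using hE⟩
    have : x = fun _ => ∅ := by
      funext t
      simpa [hin] using hx t
    rwa [this]
  · intro ρ hρ
    simp only [graphCause, Set.mem_ofPred_eq, not_forall] at hρ
    obtain ⟨x, s, hxs, hle, hx⟩ := hρ
    have hin : inputPart (O := Empty) (fun t => Sum.inl '' x t) = x := by
      funext t
      exact Set.preimage_image_eq _ Sum.inl_injective
    refine ⟨fun t => Sum.inl '' x t, ?_, ?_, ?_⟩
    · rw [graphSystem_mem_traces_iff, hin]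
      exact ⟨s, hxs⟩
    · rwa [h0, hin, hsim]
    · simpa [hin] using hx
  · rintro ⟨C', hC', -, hcf⟩
    obtain ⟨ρ, hρ, hρ'⟩ := Set.exists_of_ssubset hC'
    obtain ⟨π', hπ', hle, hnot⟩ := hcf ρ hρ'
    obtain ⟨s, hs⟩ := (graphSystem_mem_traces_iff _ _ _).1 hπ'
    rw [h0, hsim] at hle
    exact hnot (hρ _ s hs hle)

theorem someCauseRequires_of_graph [Fintype I] [Fintype V] {P : EffectClass} {K n : ℕ} {b : ℝ}
    (src tgt : I → V) (E : Set (OmegaWord (Set I))) (hn : Fintype.card V + 2 = n) (hK : 1 ≤ K)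
    (hP : P I Empty (inputPart ⁻¹' E)) (hE : (fun _ => ∅) ∈ E)
    (hb : ∀ (Q : Type) [Fintype Q] (B : OmegaAutomaton (Set I) Q),
      B.buchiLanguage = graphCause src tgt E → b ≤ (Fintype.card Q : ℝ)) :
    SomeCauseRequires P K n b :=
  ⟨I, Empty, Option (Option V), inferInstance, inferInstance, inferInstance,
    graphSystem src tgt, fun _ => ∅, inputPart ⁻¹' E, graphCause src tgt E,
    by simpa using hn, ⟨0, 1, one_pos, by omega, fun _ _ => rfl⟩, hP,
    graphCause_isCause src tgt E hE, hb⟩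

end Graph

/-! ### Fooling sets for Büchi automata -/

section Fooling

variable {A Q : Type}

/-- The infinite word with first letter `a` and remainder `w`. -/
def consWord (a : A) (w : OmegaWord A) : OmegaWord A
  | 0 => a
  | t + 1 => w t

/-- In accepting runs on the words `consWord (u i) (w i)`, the states reached after the first
letter are pairwise different: otherwise two runs could be exchanged after the first letter. -/
theorem card_le_card_of_fooling {ι : Type} [Fintype ι] [Fintype Q] (B : OmegaAutomaton A Q)
    (u : ι → A) (w : ι → OmegaWord A) (hmem : ∀ i, consWord (u i) (w i) ∈ B.buchiLanguage)
    (hfool : ∀ i j, consWord (u i) (w j) ∈ B.buchiLanguage →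
      consWord (u j) (w i) ∈ B.buchiLanguage → i = j) :
    Fintype.card ι ≤ Fintype.card Q := by
  choose r hr hacc using hmem
  have swap : ∀ i j, r i 1 = r j 1 → consWord (u i) (w j) ∈ B.buchiLanguage := by
    intro i j hij
    refine ⟨fun t => if t = 0 then r i 0 else r j t, ⟨(hr i).1, ?_⟩, ?_⟩
    · rintro (_ | t)
      · simpa [consWord, ← hij] using (hr i).2 0
      · simpa [consWord] using (hr j).2 (t + 1)
    · refine ((hacc j).sdiff (Set.finite_singleton 0)).mono ?_
      rintro t ⟨ht, ht0⟩
      simpa [show t ≠ 0 from ht0] using ht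
  refine Fintype.card_le_of_injective (fun i => r i 1) fun i j hij => ?_
  exact hfool i j (swap i j hij) (swap j i hij.symm)

/-- An automaton whose acceptance of `u X · w Y` decides the disjointness of `X` and `Y` has to
remember the set `X`. -/
theorem two_pow_le_card_of_disjoint {J : Type} [Fintype J] [Fintype Q] (B : OmegaAutomaton A Q)
    (u : Set J → A) (w : Set J → OmegaWord A)
    (h : ∀ X Y, consWord (u X) (w Y) ∈ B.buchiLanguage ↔ Disjoint X Y) :
    2 ^ Fintype.card J ≤ Fintype.card Q := by
  classical
  rw [← Fintype.card_set]
  refine card_le_card_of_fooling B u (fun X => w Xᶜ) (fun X => (h _ _).2 disjoint_compl_right) ?_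
  intro X Y hXY hYX
  rw [h, Set.disjoint_compl_right_iff_subset] at hXY hYX
  exact hXY.antisymm hYX

end Fooling

/-! ### Guarantee effects -/

section Guarantee

variable {V : Type}

/-- A path along loops that never ends in the sink takes the same loop in all steps. -/
theorem mem_graphCause_guarantee_iff (X Y : Set V) :
    consWord X (fun _ => Y) ∈ graphCause (id : V → V) id {x | ∃ t, x t = ∅} ↔ Disjoint X Y := by
  rw [← not_iff_not, Set.not_disjoint_iff]
  simp only [graphCause, Set.mem_ofPred_eq, not_forall]
  constructor
  · rintro ⟨x, s, hs, hle, hx⟩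
    push Not at hx
    rcases hs.2 0 with ⟨h, -⟩ | ⟨i, hi, hsi, -⟩
    · exact absurd h (hx 0).ne_empty
    rcases hs.2 1 with ⟨h, -⟩ | ⟨j, hj, -, hsj⟩
    · exact absurd h (hx 1).ne_empty
    have h0 := hle 0
    have h1 := hle 1
    simp only [zero_add] at hsi
    simp only [hsi, id, Option.some.injEq, reduceCtorEq, false_or] at hsj
    subst hsj
    exact ⟨i, by simpa [hi, consWord] using h0, by simpa [hj, consWord] using h1⟩
  · rintro ⟨v, hX, hY⟩
    refine ⟨fun _ => {v}, fun t => if t = 0 then none else some (some v), ⟨rfl, fun t => ?_⟩,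
      ?_, by simp⟩
    · refine Or.inr ⟨v, rfl, rfl, ?_⟩
      by_cases ht : t = 0 <;> simp [ht]
    · rintro (_ | t) <;> simpa [consWord]

end Guarantee

/-! ### Safety effects -/

section Safety

variable {V : Type}

/-- The marked loops are the edges `(true, v)`. After the loops at the vertices in `X`, the marked
loops at the vertices in `Y` can be used if and only if `X` and `Y` intersect. -/
theorem mem_graphCause_safety_iff (X Y : Set V) :
    consWord (Prod.mk false '' X) (consWord (Prod.mk true '' Y) fun _ => ∅) ∈
      graphCause (Prod.snd : Bool × V → V) Prod.snd {x | ∀ t, ¬ ∃ v, (true, v) ∈ x t} ↔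
        Disjoint X Y := by
  rw [← not_iff_not, Set.not_disjoint_iff]
  simp only [graphCause, Set.mem_ofPred_eq, not_forall, not_not]
  constructor
  · rintro ⟨x, s, hs, hle, t, v, hv⟩
    have htv := hle t hv
    rcases t with _ | _ | t
    · simp [consWord] at htv
    · rcases hs.2 0 with ⟨h, -⟩ | ⟨i, hi, hsi, -⟩
      · have := hs.eq_empty_of_le h zero_le_one
        simp [this] at hv
      rcases hs.2 1 with ⟨h, -⟩ | ⟨j, hj, -, hsj⟩
      · simp [h] at hv
      have h0 := hle 0
      simp only [zero_add] at hsi hv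
      simp only [hsi, Option.some.injEq, reduceCtorEq, false_or] at hsj
      rw [hj, Set.mem_singleton_iff] at hv
      subst hv
      refine ⟨v, ?_, by simpa [consWord] using htv⟩
      obtain ⟨b, w⟩ := i
      obtain rfl : w = v := hsj
      rw [hi] at h0
      simp only [consWord, Set.singleton_subset_iff] at h0
      obtain ⟨w', hw', h⟩ := h0
      simp only [Prod.mk.injEq] at h
      exact h.2 ▸ hw'
    · simp [consWord] at htv
  · rintro ⟨v, hX, hY⟩
    refine ⟨consWord {(false, v)} (consWord {(true, v)} fun _ => ∅),
      fun t => if t = 0 then none else if t ≤ 2 then some (some v) else some none,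
      ⟨rfl, ?_⟩, ?_, 1, v, by simp [consWord]⟩
    · rintro (_ | _ | t)
      · exact Or.inr ⟨(false, v), rfl, by simp, by simp⟩
      · exact Or.inr ⟨(true, v), rfl, by simp, by simp⟩
      · exact Or.inl ⟨rfl, by simp⟩
    · rintro (_ | _ | t) <;> simp [consWord, hX, hY]

end Safety

/-! ### Recurrence effects -/

section Recurrence

variable {V : Type}

open Classical in
/-- The transition function of a deterministic automaton that compares the colours of the edges
along a path. It is in state `none` initially and after every letter without inputs, it is in state
`some (some b)` as long as edges of colour `b` are taken, and it moves to `some none` forever when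
the colour changes. -/
noncomputable def colourStep : Option (Option Bool) → Set (Bool × V) → Option (Option Bool)
  | none, a =>
    if ∃ v, (true, v) ∈ a then some (some true) else
      if ∃ v, (false, v) ∈ a then some (some false) else none
  | some none, _ => some none
  | some (some b), a =>
    if ∃ v, (b, v) ∈ a then some (some b) else
      if ∃ v, (!b, v) ∈ a then some none else none

/-- The words on which the automaton of `colourStep` is in one of the states `none` and `some none`
infinitely often. For the input words of the graph system with loops `(b, v)`, these are the words
in which the colour changes or the inputs are eventually empty. -/
def colourEffect (V : Type) : Set (OmegaWord (Set (Bool × V))) :=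
  {x | {t | detRun colourStep none x t ∈ ({none, some none} : Set _)}.Infinite}

theorem detRun_preimage {A A' Q : Type} (f : A' → A) (step : Q → A → Q) (q₀ : Q)
    (w : OmegaWord A') (t : ℕ) :
    detRun (fun q a => step q (f a)) q₀ w t = detRun step q₀ (fun t => f (w t)) t := by
  induction t with
  | zero => rfl
  | succ t ih => simp only [detRun, ih]

theorem recurrenceEffect_colourEffect :
    RecurrenceEffect 4 (Bool × V) Empty (inputPart ⁻¹' colourEffect V) := by
  have := recurrenceEffect_detRun (I := Bool × V) (O := Empty) (K := 4) (by simp)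
    (fun q a => colourStep q (Sum.inl ⁻¹' a)) none {none, some none}
  simp only [detRun_preimage] at this
  exact this

theorem colourStep_singleton_none (i : Bool × V) :
    colourStep none {i} = some (some i.1) := by
  obtain ⟨_ | _, v⟩ := i <;> simp [colourStep]

theorem colourStep_singleton_self (i : Bool × V) :
    colourStep (some (some i.1)) {i} = some (some i.1) := by
  obtain ⟨b, v⟩ := i
  simp [colourStep]

theorem colourStep_singleton_of_ne {b : Bool} {i : Bool × V} (h : b ≠ i.1) :
    colourStep (some (some b)) {i} = some none := by
  obtain ⟨b', v⟩ := i
  cases b <;> cases b' <;> simp_all [colourStep]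

theorem colourStep_empty (q : Option (Option Bool)) :
    colourStep q (∅ : Set (Bool × V)) ∈ ({none, some none} : Set _) := by
  rcases q with _ | _ | b <;> simp [colourStep]

theorem mem_colourEffect_of_empty {x : OmegaWord (Set (Bool × V))} {t₀ : ℕ}
    (h : ∀ t ≥ t₀, x t = ∅) : x ∈ colourEffect V := by
  refine Set.infinite_of_forall_exists_gt fun t => ⟨t₀ + t + 1, ?_, by omega⟩
  simp only [Set.mem_ofPred_eq, detRun, h (t₀ + t) (by omega)]
  exact colourStep_empty _

theorem mem_colourEffect_of_absorbed {x : OmegaWord (Set (Bool × V))} {t₀ : ℕ}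
    (h : detRun colourStep none x t₀ = some none) : x ∈ colourEffect V := by
  have key : ∀ t ≥ t₀, detRun colourStep none x t = some none := by
    intro t ht
    induction t, ht using Nat.le_induction with
    | base => exact h
    | succ t _ ih => simp [detRun, ih, colourStep]
  refine Set.infinite_of_forall_exists_gt fun t => ⟨t₀ + t + 1, ?_, by omega⟩
  simp [key (t₀ + t + 1) (by omega)]

/-- A path that violates the effect stays at one vertex, as all edges are loops, and keeps one
colour, as the effect remembers it; hence it takes one and the same edge in all steps. -/
theorem mem_graphCause_colourEffect_iff (X Y : Set (Bool × V)) :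
    consWord X (fun _ => Y) ∈
      graphCause (Prod.snd : Bool × V → V) Prod.snd (colourEffect V) ↔ Disjoint X Y := by
  rw [← not_iff_not, Set.not_disjoint_iff]
  simp only [graphCause, Set.mem_ofPred_eq, not_forall]
  constructor
  · rintro ⟨x, s, hs, hle, hx⟩
    rcases hs.2 0 with ⟨h, -⟩ | ⟨i, hi, hsi, -⟩
    · exact absurd (mem_colourEffect_of_empty fun t ht => hs.eq_empty_of_le h ht) hx
    rcases hs.2 1 with ⟨h, -⟩ | ⟨j, hj, -, hsj⟩
    · exact absurd (mem_colourEffect_of_empty fun t ht => hs.eq_empty_of_le h ht) hx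
    simp only [zero_add] at hsi
    simp only [hsi, Option.some.injEq, reduceCtorEq, false_or] at hsj
    have hcol : i.1 = j.1 := by
      by_contra hne
      refine hx (mem_colourEffect_of_absorbed (t₀ := 2) ?_)
      rw [detRun, detRun, detRun, hi, hj, colourStep_singleton_none,
        colourStep_singleton_of_ne hne]
    obtain rfl : i = j := Prod.ext hcol hsj
    have h0 := hle 0
    have h1 := hle 1
    exact ⟨i, by simpa [hi, consWord] using h0, by simpa [hj, consWord] using h1⟩
  · rintro ⟨i, hX, hY⟩
    refine ⟨fun _ => {i}, fun t => if t = 0 then none else some (some i.2),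
      ⟨rfl, fun t => ?_⟩, ?_, ?_⟩
    · refine Or.inr ⟨i, rfl, rfl, ?_⟩
      by_cases ht : t = 0 <;> simp [ht]
    · rintro (_ | t) <;> simpa [consWord]
    · have key : ∀ t, detRun colourStep none (fun _ => {i}) (t + 1) = some (some i.1) := by
        intro t
        induction t with
        | zero => exact colourStep_singleton_none i
        | succ t ih => rw [detRun, ih, colourStep_singleton_self]
      refine Set.not_infinite.2 ((Set.finite_singleton 0).subset ?_)
      rintro (_ | t) ht
      · rfl
      · simp [key t] at ht

end Recurrence

/-! ### Persistence effects -/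

section Lasso

/-- The position of a finite lasso of length `p + c` that is reached after `t` steps, where
position `p + c` is identified with position `p`. -/
def lassoPos (p c t : ℕ) : ℕ :=
  if t < p then t else p + (t - p) % c

variable {p c : ℕ}

theorem lassoPos_zero : lassoPos p c 0 = 0 := by
  unfold lassoPos
  split_ifs with h
  · rfl
  · simp; omega

theorem lassoPos_lt (hc : 0 < c) (t : ℕ) : lassoPos p c t < p + c := by
  unfold lassoPos
  have := Nat.mod_lt (t - p) hc
  split_ifs <;> omega

theorem lassoPos_succ (hc : 0 < c) (t : ℕ) :
    lassoPos p c (t + 1) = lassoPos p c t + 1 ∨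
      lassoPos p c t + 1 = p + c ∧ lassoPos p c (t + 1) = p := by
  unfold lassoPos
  have hlt := Nat.mod_lt (t - p) hc
  rcases lt_trichotomy (t + 1) p with h | h | h
  · simp [h, show t < p by omega]
  · simp [← h]
  · rw [if_neg (by omega), if_neg (by omega), show t + 1 - p = t - p + 1 by omega]
    rcases Nat.lt_or_ge ((t - p) % c + 1) c with h' | h'
    · left
      rw [Nat.add_mod_of_add_mod_lt]
      · rcases Nat.lt_or_ge 1 c with h1 | h1
        · rw [Nat.mod_eq_of_lt h1]; omega
        · omega
      · exact (Nat.add_le_add_left (Nat.mod_le _ _) _).trans_lt h'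
    · right
      have : (t - p) % c + 1 = c := by omega
      refine ⟨by omega, ?_⟩
      rw [Nat.add_mod, ← Nat.add_mod_mod, Nat.mod_mod, ← Nat.add_mod, ← Nat.mod_add_mod, this]
      simp

theorem infinite_lassoPos_eq (hc : 0 < c) : {t | lassoPos p c t = p}.Infinite := by
  refine Set.infinite_of_forall_exists_gt fun t => ⟨p + c * (t + 1), ?_, ?_⟩
  · simp [lassoPos]
  · nlinarith

theorem mem_buchiLanguage_lasso {A Q : Type} (B : OmegaAutomaton A Q) (hc : 0 < c)
    (y : ℕ → A) (r : ℕ → Q) (h0 : r 0 ∈ B.init)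
    (hstep : ∀ t < p + c, r (t + 1) ∈ B.trans (r t) (y t)) (hloop : r (p + c) = r p)
    (hacc : r p ∈ B.acc) :
    (fun t => y (lassoPos p c t)) ∈ B.buchiLanguage := by
  refine ⟨fun t => r (lassoPos p c t), ⟨by simpa [lassoPos_zero] using h0, fun t => ?_⟩, ?_⟩
  · have := hstep _ (lassoPos_lt hc t)
    rcases lassoPos_succ (p := p) hc t with h | ⟨h, h'⟩
    · simpa only [h] using this
    · rw [h, hloop] at this
      simpa only [h'] using this
  · refine (infinite_lassoPos_eq (p := p) hc).mono fun t ht => ?_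
    simpa [show lassoPos p c t = p from ht] using hacc

end Lasso

section Persistence

variable {m : ℕ}

/-- The words with finitely many marked edges; the marked edges are those of the form
`(true, v, v')`. -/
def markEffect (m : ℕ) : Set (OmegaWord (Set (Bool × Fin m × Fin m))) :=
  {x | {t | ∃ e, (true, e) ∈ x t}.Finite}

/-- The graph of a permutation `σ`, read as a ranking of the vertices: the marked edges are those
along which the rank decreases, and every vertex has an unmarked loop. -/
def rankGraph (σ : Equiv.Perm (Fin m)) : Set (Bool × Fin m × Fin m) :=
  {i | (i.1 = true ∧ σ i.2.2 < σ i.2.1) ∨ (i.1 = false ∧ i.2.2 = i.2.1)}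

/-- Along a path through `rankGraph σ` the rank never increases, and it decreases along every
marked edge; so marked edges occur only finitely often. -/
theorem rankGraph_mem_graphCause (σ : Equiv.Perm (Fin m)) :
    (fun _ => rankGraph σ) ∈ graphCause (fun i : Bool × Fin m × Fin m => i.2.1)
      (fun i => i.2.2) (markEffect m) := by
  intro x s hs hle
  -- the initial state gets the largest rank and the sink the least one
  let f : Option (Option (Fin m)) → ℕ := fun
    | none => m + 1
    | some none => 0
    | some (some v) => σ v + 1
  have hdesc : ∀ t, f (s (t + 1)) ≤ f (s t) ∧
      ((∃ e, (true, e) ∈ x t) → f (s (t + 1)) < f (s t)) := by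
    intro t
    rcases hs.2 t with ⟨hx, hst⟩ | ⟨⟨b, v, v'⟩, hx, hst, hsrc⟩
    · simp [hx, hst, f]
    · have hmem := hle t
      rw [hx, Set.singleton_subset_iff] at hmem
      have hlt := (σ v').isLt
      rw [hst, hx]
      rcases hsrc with h | h <;> rw [h] <;> rcases hmem with ⟨h1, h2⟩ | ⟨h1, h2⟩ <;>
        (simp_all [f]; try omega)
  have hanti : Antitone fun t => f (s t) := antitone_nat_of_succ_le fun t => (hdesc t).1
  obtain ⟨k, hk⟩ := WellFoundedLT.antitone_chain_condition hanti
  refine (Set.finite_Iio k).subset fun t ht => ?_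
  by_contra hkt
  have hkt : k ≤ t := not_lt.1 hkt
  have h1 := hk t hkt
  have h2 := hk (t + 1) (by omega)
  have h3 := (hdesc t).2 ht
  omega

theorem exists_inversion_of_ne {σ τ : Equiv.Perm (Fin m)} (h : σ ≠ τ) :
    ∃ a b, σ b < σ a ∧ τ a < τ b := by
  by_contra! hcon
  have hmono : StrictMono (τ ∘ σ.symm) := by
    intro i j hij
    have hle := hcon (σ.symm j) (σ.symm i) (by simpa using hij)
    refine lt_of_le_of_ne hle fun heq => hij.ne ?_
    simpa using heq
  -- the only order automorphism of `Fin m` is the identity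
  have hid : hmono.orderIsoOfSurjective _ (τ.surjective.comp σ.symm.surjective) =
      OrderIso.refl _ := Subsingleton.elim _ _
  refine h (Equiv.ext fun v => ?_)
  simpa using (DFunLike.congr_fun hid (σ v)).symm

/-- Repeating a block of at least one letter `rankGraph σ` and a block of at least one letter
`rankGraph τ`, for different rankings, allows infinitely many marked edges: some marked edge of
`rankGraph σ` is the converse of a marked edge of `rankGraph τ`. -/
theorem lasso_notMem_graphCause {σ τ : Equiv.Perm (Fin m)} (h : σ ≠ τ) {p p' c : ℕ}
    (hp : p < p') (hc : p' < p + c) :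
    (fun t => if lassoPos p c t < p' then rankGraph σ else rankGraph τ) ∉
      graphCause (fun i : Bool × Fin m × Fin m => i.2.1) (fun i => i.2.2) (markEffect m) := by
  obtain ⟨a, b, hσ, hτ⟩ := exists_inversion_of_ne h
  have hc0 : 0 < c := by omega
  -- the path moves from `a` to `b` at position `p` and back to `a` at position `p'`
  let z : ℕ → Fin m := fun j => if p < j ∧ j ≤ p' then b else a
  let e : ℕ → Bool × Fin m × Fin m := fun j => (decide (j = p ∨ j = p'), z j, z (j + 1))
  have hz : ∀ t, z (lassoPos p c (t + 1)) = z (lassoPos p c t + 1) := by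
    intro t
    rcases lassoPos_succ (p := p) hc0 t with h | ⟨h, h'⟩
    · rw [h]
    · rw [h, h']
      simp [z, hc]
  intro hmem
  refine (infinite_lassoPos_eq (p := p) hc0).mono (fun t ht => ?_) (hmem
    (fun t => {e (lassoPos p c t)})
    (fun t => if t = 0 then none else some (some (z (lassoPos p c t)))) ⟨rfl, fun t => ?_⟩
    fun t => ?_)
  · exact ⟨(a, b), by simp [show lassoPos p c t = p from ht, e, z, hp]⟩
  · refine Or.inr ⟨_, rfl, by simp [e, hz], ?_⟩
    by_cases ht : t = 0 <;> simp [ht, e]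
  · rw [Set.singleton_subset_iff]
    beta_reduce
    generalize lassoPos p c t = j
    by_cases h1 : j = p
    · subst h1
      simp [hp, rankGraph, e, z, hσ]
    by_cases h2 : j = p'
    · subst h2
      simp [hp, rankGraph, e, z, hτ]
    have h3 : z (j + 1) = z j := by
      have : (p < j + 1 ∧ j + 1 ≤ p') ↔ (p < j ∧ j ≤ p') := by omega
      simp only [z, this]
    split_ifs <;> simp [rankGraph, e, h1, h2, h3]

/-- Accepting runs on the constant words of different permutations cannot visit a common accepting
state infinitely often: otherwise loops through it on both words could be alternated. -/
theorem factorial_le_card_of_buchiLanguage_eq {Q : Type} [Fintype Q]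
    (B : OmegaAutomaton (Set (Bool × Fin m × Fin m)) Q)
    (hB : B.buchiLanguage =
      graphCause (fun i => i.2.1) (fun i => i.2.2) (markEffect m)) :
    m.factorial ≤ Fintype.card Q := by
  have hmem : ∀ σ : Equiv.Perm (Fin m), ∃ (r : ℕ → Q) (q : Q),
      B.IsRun (fun _ => rankGraph σ) r ∧ q ∈ B.acc ∧ {t | r t = q}.Infinite := by
    intro σ
    have := rankGraph_mem_graphCause σ
    rw [← hB] at this
    obtain ⟨r, hr, hinf⟩ := this
    by_contra! hcon
    exact hinf ((Set.toFinite B.acc).preimage' fun q hq => hcon r q hr hq)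
  choose r q hr hq hinf using hmem
  suffices Fintype.card (Equiv.Perm (Fin m)) ≤ Fintype.card Q by
    rwa [Fintype.card_perm, Fintype.card_fin] at this
  refine Fintype.card_le_of_injective q fun σ τ hqq => ?_
  by_contra hne
  obtain ⟨p, hp⟩ := (hinf σ).nonempty
  obtain ⟨p', hp', hpp'⟩ := (hinf σ).exists_gt p
  obtain ⟨d, hd⟩ := (hinf τ).nonempty
  obtain ⟨d', hd', hdd'⟩ := (hinf τ).exists_gt d
  simp only [Set.mem_ofPred_eq] at hp hp' hd hd'
  obtain ⟨c, hc⟩ : ∃ c, p + c = p' + (d' - d) := ⟨p' - p + (d' - d), by omega⟩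
  refine lasso_notMem_graphCause hne hpp' (c := c) (by omega) ?_
  rw [← hB]
  refine mem_buchiLanguage_lasso B (by omega)
    (fun t => if t < p' then rankGraph σ else rankGraph τ)
    (fun t => if t < p' then r σ t else r τ (d + (t - p'))) ?_ (fun t ht => ?_) ?_ ?_
  · simpa [show 0 < p' by omega] using (hr σ).1
  · rcases lt_trichotomy (t + 1) p' with h | h | h
    · simpa [h, show t < p' by omega] using (hr σ).2 t
    · have := (hr σ).2 t
      rw [h, hp', hqq, ← hd] at this
      simpa [h, show t < p' by omega] using this
    · have := (hr τ).2 (d + (t - p'))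
      simpa [show ¬ t + 1 < p' by omega, show ¬ t < p' by omega,
        show d + (t + 1 - p') = d + (t - p') + 1 by omega] using this
  · simp [hc, hpp', hp, hqq, show d + (d' - d) = d' by omega, hd']
  · simpa [hpp', hp] using hq σ

end Persistence

/-! ### A lower bound on the factorial -/

theorem two_rpow_le_factorial {m : ℕ} (hm : 14 ≤ m) :
    (2 : ℝ) ^ ((1 / 8 : ℝ) * (((m + 2 : ℕ) : ℝ) * Real.logb 2 ((m + 2 : ℕ) : ℝ))) ≤
      (m.factorial : ℝ) := by
  set n : ℕ := m + 2 with hn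
  have hn0 : (0 : ℝ) < n := by positivity
  have hn1 : (16 : ℝ) ≤ n := by
    rw [hn]
    exact_mod_cast (by omega : 16 ≤ m + 2)
  set k := m / 2 with hk
  have hfac : k ^ (m - k) ≤ m.factorial :=
    (Nat.le_mul_of_pos_left _ k.factorial_pos).trans
      (Nat.factorial_mul_pow_sub_le_factorial (Nat.div_le_self m 2))
  have hk4 : (n : ℝ) / 4 ≤ k := by
    have : n ≤ 4 * k := by omega
    have : (n : ℝ) ≤ 4 * k := by exact_mod_cast this
    linarith
  have hmk : (n : ℝ) / 4 ≤ (m - k : ℕ) := by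
    have : n ≤ 4 * (m - k) := by omega
    have : (n : ℝ) ≤ 4 * (m - k : ℕ) := by exact_mod_cast this
    linarith
  -- `√n ≤ n / 4 ≤ m / 2`, up to rounding
  have hsqrt : (n : ℝ) ^ (1 / 2 : ℝ) ≤ k := by
    rw [← Real.sqrt_eq_rpow]
    refine le_trans ?_ hk4
    rw [Real.sqrt_le_left (by positivity)]
    nlinarith
  have hk1 : (1 : ℝ) ≤ k := by linarith
  calc (2 : ℝ) ^ ((1 / 8 : ℝ) * ((n : ℝ) * Real.logb 2 (n : ℝ)))
      = ((n : ℝ) ^ (1 / 2 : ℝ)) ^ ((n : ℝ) / 4) := by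
        rw [← Real.rpow_mul hn0.le,
          show (1 / 8 : ℝ) * ((n : ℝ) * Real.logb 2 (n : ℝ)) =
            Real.logb 2 (n : ℝ) * (1 / 2 * (n / 4)) by ring,
          Real.rpow_mul (by norm_num), Real.rpow_logb (by norm_num) (by norm_num) hn0]
    _ ≤ (k : ℝ) ^ ((n : ℝ) / 4) := Real.rpow_le_rpow (by positivity) hsqrt (by positivity)
    _ ≤ (k : ℝ) ^ (((m - k : ℕ) : ℝ)) := Real.rpow_le_rpow_of_exponent_le hk1 hmk
    _ = ((k ^ (m - k) : ℕ) : ℝ) := by rw [Real.rpow_natCast]; push_cast; rfl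
    _ ≤ (m.factorial : ℝ) := by exact_mod_cast hfac

/-! ### Lower bounds -/

theorem mainTheorem6 :
    (∃ K : ℕ, ∃ c : ℝ, 0 < c ∧ ∃ N : ℕ, ∀ n ≥ N,
      SomeCauseRequires (PersistenceEffect K) K n
        ((2 : ℝ) ^ (c * ((n : ℝ) * Real.logb 2 (n : ℝ))))) ∧
    (∃ K : ℕ, ∃ c : ℝ, 0 < c ∧ ∃ N : ℕ, ∀ n ≥ N,
      SomeCauseRequires (RecurrenceEffect K) K n (c * (3 : ℝ) ^ n)) ∧
    (∃ K : ℕ, ∃ c : ℝ, 0 < c ∧ ∃ N : ℕ, ∀ n ≥ N,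
      SomeCauseRequires (SafetyEffect K) K n (c * (2 : ℝ) ^ n)) ∧
    (∃ K : ℕ, ∃ c : ℝ, 0 < c ∧ ∃ N : ℕ, ∀ n ≥ N,
      SomeCauseRequires (GuaranteeEffect K) K n (c * (2 : ℝ) ^ n)) := by
  refine ⟨⟨2, 1 / 8, by norm_num, 16, fun n hn => ?_⟩,
    ⟨4, 1 / 16, by norm_num, 2, fun n hn => ?_⟩,
    ⟨2, 1 / 4, by norm_num, 2, fun n hn => ?_⟩, ⟨2, 1 / 4, by norm_num, 2, fun n hn => ?_⟩⟩
  · obtain ⟨m, rfl⟩ := Nat.exists_eq_add_of_le' (show 2 ≤ n by omega)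
    refine someCauseRequires_of_graph (fun i : Bool × Fin m × Fin m => i.2.1) (fun i => i.2.2)
      (markEffect m) (by simp) one_le_two
      (persistenceEffect_finite fun a => ∃ e, (true, e) ∈ Sum.inl ⁻¹' a) (by simp [markEffect]) ?_
    intro Q _ B hB
    refine (two_rpow_le_factorial (by omega)).trans ?_
    exact_mod_cast factorial_le_card_of_buchiLanguage_eq B hB
  · obtain ⟨m, rfl⟩ := Nat.exists_eq_add_of_le' hn
    refine someCauseRequires_of_graph (Prod.snd : Bool × Fin m → Fin m) Prod.snd
      (colourEffect (Fin m)) (by simp) (by norm_num) recurrenceEffect_colourEffect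
      (mem_colourEffect_of_empty (t₀ := 0) fun _ _ => rfl) ?_
    intro Q _ B hB
    have hcard := two_pow_le_card_of_disjoint B (fun X : Set (Bool × Fin m) => X)
      (fun Y _ => Y) (by rw [hB]; exact mem_graphCause_colourEffect_iff)
    rw [Fintype.card_prod, Fintype.card_bool, Fintype.card_fin, pow_mul] at hcard
    have hcard' : (4 : ℝ) ^ m ≤ Fintype.card Q := by exact_mod_cast hcard
    -- two colours at each of the `m` vertices give `2 ^ (2 * m)` sets of edges
    have hpow : (3 : ℝ) ^ m ≤ 4 ^ m := pow_le_pow_left₀ (by norm_num) (by norm_num) m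
    have hpos : (0 : ℝ) < 3 ^ m := by positivity
    rw [pow_add]
    linarith
  · obtain ⟨m, rfl⟩ := Nat.exists_eq_add_of_le' hn
    refine someCauseRequires_of_graph (Prod.snd : Bool × Fin m → Fin m) Prod.snd
      {x | ∀ t, ¬ ∃ v, (true, v) ∈ x t} (by simp) one_le_two
      (safetyEffect_forall_not fun a => ∃ v, (true, v) ∈ Sum.inl ⁻¹' a) (by simp) ?_
    intro Q _ B hB
    have hcard := two_pow_le_card_of_disjoint B (fun X : Set (Fin m) => Prod.mk false '' X)
      (fun Y => consWord (Prod.mk true '' Y) fun _ => ∅)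
      (by rw [hB]; exact mem_graphCause_safety_iff)
    rw [Fintype.card_fin] at hcard
    have hcard' : (2 : ℝ) ^ m ≤ Fintype.card Q := by exact_mod_cast hcard
    rw [pow_add]
    linarith
  · obtain ⟨m, rfl⟩ := Nat.exists_eq_add_of_le' hn
    refine someCauseRequires_of_graph (id : Fin m → Fin m) id
      {x | ∃ t, x t = ∅} (by simp) one_le_two
      (guaranteeEffect_exists fun a => Sum.inl ⁻¹' a = ∅) (by simp) ?_
    intro Q _ B hB
    have hcard := two_pow_le_card_of_disjoint B (fun X : Set (Fin m) => X) (fun Y _ => Y)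
      (by rw [hB]; exact mem_graphCause_guarantee_iff)
    rw [Fintype.card_fin] at hcard
    have hcard' : (2 : ℝ) ^ m ≤ Fintype.card Q := by exact_mod_cast hcard
    rw [pow_add]
    linarith
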